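/- Let $G$ be a finite cubic graph (loops and parallel edges are allowed) and let $R\subseteq V(G)$. Define a signed graph $G'$ as follows: each vertex $v\in R$ is replaced by three new vertices (corners), the three edge-ends of $G$ at $v$ are attached to the three corners, one to each, and any two of the corners are joined by one positive and one negative edge; all edges of $G$ are positive in $G'$. Let $X_v$ be the set of the six new edges at $v$. The restriction of the signed-graphic matroid $M(G')$ to $X_v$ is a copy of $M(K_4)$; regard this $K_4$ as a subgraph of a complete graph $K_5$ on one further vertex, whose four further edges are new elements. The ornamentation $Or(G,R)$ is the matroid obtained from $M(G')$ by taking, for each $v\in R$ in turn, the generalized parallel connection with this copy of $M(K_5)$ over $X_v$, and then deleting all the sets $X_v$. (The generalized parallel connection of $M_1$ and $M_2$, which agree on the common part of their ground sets $E_1$ and $E_2$, is the matroid on $E_1\cup E_2$ whose flats are the sets $F$ such that $F\cap E_1$ is a flat of $M_1$ and $F\cap E_2$ is a flat of $M_2$.) Then, however the edge-ends are attached to the corners, $Or(G,R)$ is well defined (the generalized parallel connections exist, and the result does not depend on their order), it is dyadic, that is, representable over both $\mathrm{GF}(3)$ and $\mathrm{GF}(5)$, and it has the cycle matroid $M(G)$,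 on the ground set $E(G)$, as a minor. -/

import Mathlib

open Set

/-! ## Representability and dyadic matroids -/

/-- `M` is the vector matroid of a matrix over `F`: the elements `e` of the ground set index the
columns `v e` (vectors with finitely many entries), and a subset of the ground set is independent
exactly when the family of its columns is linearly independent. -/
def Matroid.IsRepresentableOver {α : Type*} (M : Matroid α) (F : Type*) [Field F] : Prop :=
  ∃ (n : ℕ) (v : α → Fin n → F), ∀ I ⊆ M.E, (M.Indep I ↔ LinearIndepOn F v I)

instance instFactPrimeFive : Fact (Nat.Prime 5) := ⟨Nat.prime_five⟩

/-- A matroid is dyadic if it is representable over both `GF(3)` and `GF(5)`. -/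
def Matroid.IsDyadic {α : Type*} (M : Matroid α) : Prop :=
  M.IsRepresentableOver (ZMod 3) ∧ M.IsRepresentableOver (ZMod 5)

/-! ## Graphs, signed graphs and their matroids

Graphs may have loops and parallel edges. -/

/-- Every vertex has degree three, a loop counting twice. -/
def Graph.IsCubic {V E : Type*} (G : Graph V E) : Prop :=
  ∀ v ∈ G.vertexSet, {e | G.IsNonloopAt e v}.encard + 2 * {e | G.IsLoopAt e v}.encard = 3

/-- `x` and `y` are joined by a walk all of whose edges are in `S`. -/
def Graph.JoinedBy {V E : Type*} (G : Graph V E) (S : Set E) : V → V → Prop :=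
  Relation.ReflTransGen (fun a b => ∃ f ∈ S, G.IsLink f a b)

/-- A set of edges is a forest: no edge `e` of `I` lies on a cycle inside `I`, that is, the ends
of `e` are not joined by a walk in `I \ {e}`. (A loop is never in a forest: take the trivial
walk.) -/
def Graph.IsForest {V E : Type*} (G : Graph V E) (I : Set E) : Prop :=
  I ⊆ G.edgeSet ∧ ∀ e ∈ I, ∀ x y, G.IsLink e x y → ¬ G.JoinedBy (I \ {e}) x y

/-- A signed graph: each edge has a sign `+1` or `-1`. (Signs of labels that are not edges of the
graph play no role.) -/
structure SignedGraph (V E : Type*) extends Graph V E where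
  sign : E → ℤˣ

namespace SignedGraph

variable {V E : Type*}

/-- `Γ.Walk S x y s`: there is a walk from `x` to `y` all of whose edges are in `S` and the product
of whose edge signs is `s`. -/
inductive Walk (Γ : SignedGraph V E) (S : Set E) : V → V → ℤˣ → Prop
  | nil (x : V) : Walk Γ S x x 1
  | cons {x y z : V} {s : ℤˣ} (f : E) (hf : f ∈ S) (hl : Γ.IsLink f x y)
      (h : Walk Γ S y z s) : Walk Γ S x z (Γ.sign f * s)

/-- The component of `x` in the subgraph with edge set `S` is unbalanced, that is, it contains a
cycle with an odd number of negative edges; equivalently, there is a negative closed walk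
at `x`. -/
def UnbalancedAt (Γ : SignedGraph V E) (S : Set E) (x : V) : Prop := Γ.Walk S x x (-1)

/-- An edge `e` outside `S` is spanned by `S` in the signed-graphic matroid if it completes a
circuit with edges of `S`: either a positive cycle (its ends are joined in `S` by a walk of the same
sign as `e`), or a pair of negative cycles joined together through `e` (both ends of `e` are in
unbalanced components of `S`). -/
def Spans (Γ : SignedGraph V E) (S : Set E) (e : E) : Prop :=
  ∃ x y, Γ.IsLink e x y ∧
    (Γ.Walk S x y (Γ.sign e) ∨ (Γ.UnbalancedAt S x ∧ Γ.UnbalancedAt S y))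

/-- Independence in the signed-graphic matroid: no edge of `I` is spanned by the others; that is,
`I` contains no positive cycle and no two negative cycles in the same component. -/
def IsIndep (Γ : SignedGraph V E) (I : Set E) : Prop :=
  I ⊆ Γ.edgeSet ∧ ∀ e ∈ I, ¬ Γ.Spans (I \ {e}) e

end SignedGraph

/-! The next facts show that the independent sets above are those of a matroid, by means of the
signed incidence matrix. -/

/-- Linear independence of subfamilies of a family of vectors defines a matroid. -/
theorem exists_matroid_linearIndepOn {α K W : Type*} [Field K] [AddCommGroup W] [Module K W]
    (E : Set α) (v : α → W) :
    ∃ M : Matroid α, E = M.E ∧ ∀ I, M.Indep I ↔ I ⊆ E ∧ LinearIndepOn K v I := by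
  refine ⟨(IndepMatroid.ofFinitaryCardAugment E (fun I => I ⊆ E ∧ LinearIndepOn K v I)
    ?_ ?_ ?_ ?_ ?_).matroid, rfl, fun I => Iff.rfl⟩
  · exact ⟨empty_subset _, linearIndepOn_empty K v⟩
  · exact fun I J hJ hIJ => ⟨hIJ.trans hJ.1, hJ.2.mono hIJ⟩
  · rintro I J ⟨hIE, hI⟩ hIf ⟨hJE, hJ⟩ hJf hlt
    by_contra! hcon
    have hspan : ∀ e ∈ J, v e ∈ Submodule.span K (v '' I) := by
      intro e he
      by_cases heI : e ∈ I
      · exact Submodule.subset_span ⟨e, heI, rfl⟩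
      · by_contra hns
        exact hcon e he heI (insert_subset (hJE he) hIE) (hI.insert hns)
    have hle : Submodule.span K (v '' J) ≤ Submodule.span K (v '' I) := by
      rw [Submodule.span_le]
      rintro _ ⟨e, he, rfl⟩
      exact hspan e he
    have hfd : FiniteDimensional K (Submodule.span K (v '' I)) :=
      FiniteDimensional.span_of_finite K (hIf.image v)
    have h1 := Submodule.finrank_mono hle
    have key : ∀ S : Set α, S.Finite → LinearIndepOn K v S →
        Module.finrank K (Submodule.span K (v '' S)) = S.ncard := by
      intro S hSf hS
      have := hSf.fintype
      have h := finrank_span_eq_card (R := K) (b := fun x : S => v x) hS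
      rw [image_eq_range, h, ← Nat.card_eq_fintype_card, Nat.card_coe_set_eq]
    rw [key I hIf hI, key J hJf hJ] at h1
    omega
  · refine fun I h => ⟨fun e he => ?_, ?_⟩
    · exact (h {e} (singleton_subset_iff.2 he) (finite_singleton e)).1 rfl
    · exact linearIndepOn_of_finite I fun t ht htf => (h t ht htf).2
  · exact fun I h => h.1

namespace SignedGraph

variable {V E : Type*}

theorem Walk.append {Γ : SignedGraph V E} {S : Set E} {x y z : V} {s t : ℤˣ}
    (h : Γ.Walk S x y s) (h' : Γ.Walk S y z t) : Γ.Walk S x z (s * t) := by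
  induction h with
  | nil x => simpa using h'
  | cons f hf hl _ ih => rw [mul_assoc]; exact .cons f hf hl (ih h')

theorem Walk.symm {Γ : SignedGraph V E} {S : Set E} {x y : V} {s : ℤˣ}
    (h : Γ.Walk S x y s) : Γ.Walk S y x s := by
  induction h with
  | nil x => exact .nil x
  | cons f hf hl _ ih =>
    have := ih.append (.cons f hf hl.symm (.nil _))
    rwa [mul_one, mul_comm] at this

open Classical in
/-- The columns of the signed incidence matrix: for an edge with ends `x`, `y` and sign `s`, the
column is `x - s y`. -/
noncomputable def column (Γ : SignedGraph V E) (K : Type*) [Field K] (e : E) : V →₀ K :=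
  if h : ∃ p : V × V, Γ.IsLink e p.1 p.2 then
    Finsupp.single h.choose.1 1 - ((Γ.sign e : ℤ) : K) • Finsupp.single h.choose.2 1
  else 0

theorem exists_column_eq (Γ : SignedGraph V E) (K : Type*) [Field K] {e : E}
    (he : e ∈ Γ.edgeSet) : ∃ x y, Γ.IsLink e x y ∧
      Γ.column K e = Finsupp.single x 1 - ((Γ.sign e : ℤ) : K) • Finsupp.single y 1 := by
  obtain ⟨x, y, hxy⟩ := (Γ.edge_mem_iff_exists_isLink e).1 he
  have h : ∃ p : V × V, Γ.IsLink e p.1 p.2 := ⟨(x, y), hxy⟩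
  exact ⟨_, _, h.choose_spec, by rw [column, dif_pos h]⟩

theorem sign_mul_self {K : Type*} [Field K] (s : ℤˣ) : ((s : ℤ) : K) * ((s : ℤ) : K) = 1 := by
  rcases Int.units_eq_one_or s with rfl | rfl <;> simp

theorem single_sub_mem_span_column {Γ : SignedGraph V E} (K : Type*) [Field K] {S : Set E} {x y : V}
    {f : E} (hf : f ∈ S) (hl : Γ.IsLink f x y) :
    Finsupp.single x 1 - ((Γ.sign f : ℤ) : K) • Finsupp.single y 1 ∈
      Submodule.span K (Γ.column K '' S) := by
  obtain ⟨a, b, hab, hc⟩ := Γ.exists_column_eq K ((Γ.edge_mem_iff_exists_isLink f).2 ⟨x, y, hl⟩)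
  have hm : Γ.column K f ∈ Submodule.span K (Γ.column K '' S) :=
    Submodule.subset_span ⟨f, hf, rfl⟩
  rcases Graph.IsLink.eq_and_eq_or_eq_and_eq hl hab with ⟨rfl, rfl⟩ | ⟨rfl, rfl⟩
  · rwa [← hc]
  · have h2 := Submodule.smul_mem _ (-((Γ.sign f : ℤ) : K)) hm
    rw [hc, smul_sub, smul_smul, neg_mul, sign_mul_self] at h2
    convert h2 using 1
    module

theorem Walk.mem_span {Γ : SignedGraph V E} (K : Type*) [Field K] {S : Set E} {x y : V} {s : ℤˣ}
    (h : Γ.Walk S x y s) : Finsupp.single x 1 - ((s : ℤ) : K) • Finsupp.single y 1 ∈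
      Submodule.span K (Γ.column K '' S) := by
  induction h with
  | nil x => simp
  | cons f hf hl _ ih =>
    have h1 := single_sub_mem_span_column K hf hl
    have h2 := Submodule.add_mem _ h1 (Submodule.smul_mem _ ((Γ.sign f : ℤ) : K) ih)
    convert h2 using 1
    push_cast
    module

/-- If `x` is in a balanced component of `S`, there is a linear functional that vanishes on the
columns of `S` and takes the value `±1` on the vertices of this component and `0` elsewhere. -/
theorem exists_functional (Γ : SignedGraph V E) (K : Type*) [Field K] (S : Set E) (hS : S ⊆ Γ.edgeSet)
    (x : V) (hx : ¬ Γ.UnbalancedAt S x) : ∃ φ : (V →₀ K) →ₗ[K] K,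
      (∀ w ∈ Submodule.span K (Γ.column K '' S), φ w = 0) ∧
      (∀ y s, Γ.Walk S x y s → φ (Finsupp.single y 1) = ((s : ℤ) : K)) ∧
      (∀ y, (∀ s, ¬ Γ.Walk S x y s) → φ (Finsupp.single y 1) = 0) := by
  classical
  let g : V → K := fun y => if h : ∃ s, Γ.Walk S x y s then ((h.choose : ℤ) : K) else 0
  have uniq : ∀ y s t, Γ.Walk S x y s → Γ.Walk S x y t → s = t := by
    intro y s t hs ht
    by_contra hne
    refine hx ?_
    have hst : s * t = -1 := by
      rcases Int.units_eq_one_or s with rfl | rfl <;> rcases Int.units_eq_one_or t with rfl | rfl <;>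
        simp_all
    have := hs.append ht.symm
    rwa [hst] at this
  have g1 : ∀ y s, Γ.Walk S x y s → g y = ((s : ℤ) : K) := by
    intro y s hs
    have h : ∃ s, Γ.Walk S x y s := ⟨s, hs⟩
    simp only [g, dif_pos h]
    rw [uniq y _ s h.choose_spec hs]
  have g0 : ∀ y, (∀ s, ¬ Γ.Walk S x y s) → g y = 0 := by
    intro y h
    simp only [g]
    rw [dif_neg]
    push Not
    exact h
  let φ : (V →₀ K) →ₗ[K] K := Finsupp.linearCombination K g
  have hφ : ∀ y, φ (Finsupp.single y 1) = g y := fun y => by simp [φ]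
  refine ⟨φ, ?_, fun y s h => by rw [hφ, g1 y s h], fun y h => by rw [hφ, g0 y h]⟩
  suffices h : Submodule.span K (Γ.column K '' S) ≤ LinearMap.ker φ from
    fun w hw => LinearMap.mem_ker.1 (h hw)
  rw [Submodule.span_le]
  rintro _ ⟨f, hf, rfl⟩
  obtain ⟨a, b, hab, hc⟩ := Γ.exists_column_eq K (hS hf)
  rw [SetLike.mem_coe, LinearMap.mem_ker, hc, map_sub, map_smul, hφ, hφ, smul_eq_mul]
  by_cases hb : ∃ s, Γ.Walk S x b s
  · obtain ⟨s, hs⟩ := hb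
    have ha := hs.append (.cons f hf (Graph.IsLink.symm hab) (.nil _))
    rw [g1 b s hs, g1 a _ ha]
    push_cast
    ring
  · push Not at hb
    rw [g0 b hb, g0 a, mul_zero, sub_zero]
    intro s hs
    exact hb _ (hs.append (.cons f hf hab (.nil _)))

theorem column_mem_span_iff (Γ : SignedGraph V E) {K : Type*} [Field K] (h2 : (2 : K) ≠ 0)
    {S : Set E} (hS : S ⊆ Γ.edgeSet) {e : E} (he : e ∈ Γ.edgeSet) :
    Γ.column K e ∈ Submodule.span K (Γ.column K '' S) ↔ Γ.Spans S e := by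
  constructor
  · intro hmem
    obtain ⟨x, y, hxy, hc⟩ := Γ.exists_column_eq K he
    refine ⟨x, y, hxy, ?_⟩
    by_contra! hcon
    have hσ := sign_mul_self (K := K) (Γ.sign e)
    by_cases hx : Γ.UnbalancedAt S x
    · have hy := hcon.2 hx
      obtain ⟨φ, h0, h1, hn⟩ := Γ.exists_functional K S hS y hy
      have h := h0 _ hmem
      rw [hc, map_sub, map_smul, smul_eq_mul, h1 y 1 (.nil y), hn x] at h
      · simp only [Units.val_one, Int.cast_one, mul_one, zero_sub, neg_eq_zero] at h
        rw [h] at hσ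
        simp at hσ
      · intro s hs
        refine hy ?_
        have := (hs.append hx).append hs.symm
        rcases Int.units_eq_one_or s with rfl | rfl <;> simpa [UnbalancedAt] using this
    · obtain ⟨φ, h0, h1, hn⟩ := Γ.exists_functional K S hS x hx
      have h := h0 _ hmem
      rw [hc, map_sub, map_smul, smul_eq_mul, h1 x 1 (.nil x)] at h
      by_cases hy : ∃ s, Γ.Walk S x y s
      · obtain ⟨s, hs⟩ := hy
        rw [h1 y s hs] at h
        have hne : s ≠ Γ.sign e := fun h => hcon.1 (h ▸ hs)
        have hs' : Γ.sign e * s = -1 := by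
          rcases Int.units_eq_one_or s with h | h <;>
            rcases Int.units_eq_one_or (Γ.sign e) with h' | h' <;> simp_all
        have hs'' : ((Γ.sign e : ℤ) : K) * ((s : ℤ) : K) = -1 := by
          rw [← Int.cast_mul, ← Units.val_mul, hs']
          simp
        rw [hs''] at h
        apply h2
        rw [← h]
        push_cast
        ring
      · push Not at hy
        rw [hn y hy] at h
        simp at h
  · rintro ⟨x, y, hxy, h⟩
    have hc : Γ.column K e ∈ Submodule.span K
        {Finsupp.single x 1 - ((Γ.sign e : ℤ) : K) • Finsupp.single y (1 : K)} := by
      obtain ⟨a, b, hab, hc⟩ := Γ.exists_column_eq K he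
      rcases Graph.IsLink.eq_and_eq_or_eq_and_eq hxy hab with ⟨rfl, rfl⟩ | ⟨rfl, rfl⟩
      · rw [hc]; exact Submodule.subset_span rfl
      · rw [hc, Submodule.mem_span_singleton]
        refine ⟨-((Γ.sign e : ℤ) : K), ?_⟩
        rw [smul_sub, smul_smul, neg_mul, sign_mul_self]
        module
    refine Submodule.span_le.2 (singleton_subset_iff.2 ?_) hc
    rcases h with h | ⟨hx, hy⟩
    · exact h.mem_span K
    · have half : ∀ z, Γ.UnbalancedAt S z →
          Finsupp.single z (1 : K) ∈ Submodule.span K (Γ.column K '' S) := by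
        intro z hz
        have h := Submodule.smul_mem _ (2 : K)⁻¹ (Walk.mem_span K hz)
        convert h using 1
        have : (1 : K) - ((-1 : ℤˣ) : ℤ) = 2 := by norm_num
        rw [Finsupp.smul_single, ← Finsupp.single_sub, Finsupp.smul_single, smul_eq_mul, smul_eq_mul,
          mul_one, this, inv_mul_cancel₀ h2]
      exact Submodule.sub_mem _ (half x hx) (Submodule.smul_mem _ _ (half y hy))

theorem isIndep_iff_linearIndepOn (Γ : SignedGraph V E) {K : Type*} [Field K] (h2 : (2 : K) ≠ 0)
    (I : Set E) : Γ.IsIndep I ↔ I ⊆ Γ.edgeSet ∧ LinearIndepOn K (Γ.column K) I := by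
  refine and_congr_right fun hI => ?_
  rw [linearIndepOn_iff_notMem_span]
  exact forall₂_congr fun e he =>
    not_congr (Γ.column_mem_span_iff h2 (sdiff_subset.trans hI) (hI he)).symm

/-- The signed-graphic matroid `M(Γ)`. -/
def matroid (Γ : SignedGraph V E) : Matroid E :=
  Matroid.ofExistsMatroid Γ.edgeSet Γ.IsIndep (by
    obtain ⟨M, hE, h⟩ := exists_matroid_linearIndepOn (K := ℚ) Γ.edgeSet (Γ.column ℚ)
    exact ⟨M, hE, fun I => by rw [h, Γ.isIndep_iff_linearIndepOn (K := ℚ) two_ne_zero]⟩)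

end SignedGraph

theorem Graph.isForest_iff_isIndep {V E : Type*} (G : Graph V E) (I : Set E) :
    G.IsForest I ↔ (SignedGraph.mk G 1).IsIndep I := by
  have hs : ∀ S x y s, (SignedGraph.mk G 1).Walk S x y s → s = 1 ∧ G.JoinedBy S x y := by
    intro S x y s h
    induction h with
    | nil x => exact ⟨rfl, .refl⟩
    | cons f hf hl _ ih => exact ⟨by simp [ih.1], .head ⟨f, hf, hl⟩ ih.2⟩
  have hw : ∀ S x y, G.JoinedBy S x y → (SignedGraph.mk G 1).Walk S x y 1 := by
    intro S x y h
    induction h using Relation.ReflTransGen.head_induction_on with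
    | refl => exact .nil _
    | head h _ ih =>
      obtain ⟨f, hf, hl⟩ := h
      exact .cons (Γ := SignedGraph.mk G 1) f hf hl ih
  refine and_congr_right fun _ => forall₂_congr fun e _ => ⟨?_, ?_⟩
  · rintro h ⟨x, y, hl, hh | hh⟩
    · exact h x y hl (hs _ _ _ _ hh).2
    · exact absurd (hs _ _ _ _ hh.1).1 (by decide)
  · exact fun h x y hl hj => h ⟨x, y, hl, .inl (hw _ _ _ hj)⟩

/-- The cycle matroid `M(G)`: its independent sets are the forests of `G`. -/
def Graph.cycleMatroid {V E : Type*} (G : Graph V E) : Matroid E :=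
  Matroid.ofExistsMatroid G.edgeSet G.IsForest
    ⟨(SignedGraph.mk G 1).matroid, rfl, fun I => (G.isForest_iff_isIndep I).symm⟩

/-! ## The generalized parallel connection -/

/-- `P` is the generalized parallel connection of `M₁` and `M₂` (over the common part
`T = M₁.E ∩ M₂.E` of the ground sets): the two matroids have the same restriction to `T`, and `P` is
the matroid on the union of the ground sets whose flats are the sets that meet each of the two
ground sets in a flat. The matroid `P` is determined by this; it exists, for instance, if `T` is a
modular flat of `M₂`. -/
structure Matroid.IsGenParallelConnection {α : Type*} (M₁ M₂ P : Matroid α) : Prop where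
  restrict_eq : M₁.restrict (M₁.E ∩ M₂.E) = M₂.restrict (M₁.E ∩ M₂.E)
  ground_eq : P.E = M₁.E ∪ M₂.E
  isFlat_iff : ∀ F ⊆ M₁.E ∪ M₂.E, (P.IsFlat F ↔ M₁.IsFlat (F ∩ M₁.E) ∧ M₂.IsFlat (F ∩ M₂.E))

/-! ## The ornamentation -/

/-- The elements that occur in the construction of the ornamentation of a graph with vertices in
`V` and edges in `E`. -/
inductive OrnElement (V E : Type*) where
  /-- an edge of the given graph -/
  | edge (e : E)
  /-- the edge of sign `s` between the two corners other than `k` in the triangle at `v` -/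
  | tri (v : V) (k : Fin 3) (s : ℤˣ)
  /-- the four elements added at `v` with the copy of `M(K₅)` -/
  | gadget (v : V) (j : Fin 4)

/-- The choices made when each vertex `v ∈ R` of `G` is replaced by a triangle with corners
`0, 1, 2`: the two ends of every edge are listed in some order, as end `0` and end `1`, and the
edge-ends at a vertex of `R` are distributed to distinct corners of its triangle. -/
structure Graph.Attachment {V E : Type*} (G : Graph V E) (R : Set V) where
  vert : G.edgeSet → Fin 2 → V
  isLink : ∀ e : G.edgeSet, G.IsLink e (vert e 0) (vert e 1)
  corner : G.edgeSet → Fin 2 → Fin 3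
  corner_inj : ∀ (e e' : G.edgeSet) (i i' : Fin 2), vert e i ∈ R → vert e i = vert e' i' →
    corner e i = corner e' i' → e = e' ∧ i = i'

/-- In a cubic graph such choices exist. -/
theorem Graph.IsCubic.nonempty_attachment {V E : Type*} {G : Graph V E} (hG : G.IsCubic)
    {R : Set V} (hR : R ⊆ G.vertexSet) : Nonempty (G.Attachment R) := by
  classical
  have hex : ∀ e : G.edgeSet, ∃ x y, G.IsLink e x y :=
    fun e => (G.edge_mem_iff_exists_isLink e).1 e.2
  choose a b hab using hex
  let vert : G.edgeSet → Fin 2 → V := fun e => ![a e, b e]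
  have hcard : ∀ v ∈ G.vertexSet,
      {p : G.edgeSet × Fin 2 | vert p.1 p.2 = v}.encard ≤ 3 := by
    intro v hv
    have hN : {p : G.edgeSet × Fin 2 | vert p.1 p.2 = v ∧ G.IsNonloopAt p.1 v}.encard ≤
        {e | G.IsNonloopAt e v}.encard := by
      refine encard_le_encard_of_injOn (f := fun p => (p.1 : E)) (fun p hp => hp.2) ?_
      rintro ⟨e, i⟩ ⟨hi, he⟩ ⟨e', i'⟩ ⟨hi', -⟩ hee
      obtain rfl : e = e' := Subtype.ext hee
      by_contra hne
      have hl : G.IsLoopAt e v := by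
        have h := hab e
        have ha : a e = v := by fin_cases i <;> fin_cases i' <;> simp_all [vert]
        have hb : b e = v := by fin_cases i <;> fin_cases i' <;> simp_all [vert]
        rwa [ha, hb] at h
      exact he.not_isLoopAt v hl
    have hL : ∀ i, {p : G.edgeSet × Fin 2 | p.2 = i ∧ G.IsLoopAt p.1 v}.encard ≤
        {e | G.IsLoopAt e v}.encard := by
      intro i
      refine encard_le_encard_of_injOn (f := fun p => (p.1 : E)) (fun p hp => hp.2) ?_
      rintro ⟨e, i⟩ ⟨rfl, he⟩ ⟨e', i'⟩ ⟨rfl, -⟩ hee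
      exact Prod.ext (Subtype.ext hee) rfl
    rw [← hG v hv, two_mul]
    refine le_trans (encard_le_encard ?_) ((encard_union_le _ _).trans (add_le_add hN
      ((encard_union_le _ _).trans (add_le_add (hL 0) (hL 1)))))
    rintro ⟨e, i⟩ h
    have hinc : G.Inc e v := by
      have h : vert e i = v := h
      subst h
      fin_cases i
      · exact (hab e).inc_left
      · exact (hab e).inc_right
    rcases hinc.isLoopAt_or_isNonloopAt with hl | hl
    · fin_cases i
      · exact .inr (.inl ⟨rfl, hl⟩)
      · exact .inr (.inr ⟨rfl, hl⟩)
    · exact .inl ⟨h, hl⟩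
  have hinj : ∀ v, ∃ c : G.edgeSet × Fin 2 → Fin 3, v ∈ R →
      InjOn c {p | vert p.1 p.2 = v} := by
    intro v
    by_cases hv : v ∈ R
    · have h := hcard v (hR hv)
      have hf : {p : G.edgeSet × Fin 2 | vert p.1 p.2 = v}.Finite :=
        finite_of_encard_le_coe (k := 3) h
      obtain ⟨c, -, hc⟩ := hf.exists_injOn_of_encard_le (t := (univ : Set (Fin 3))) (by simpa using h)
      exact ⟨c, fun _ => hc⟩
    · exact ⟨fun _ => 0, fun h => absurd h hv⟩
  choose c hc using hinj
  refine ⟨⟨vert, hab, fun e i => c (vert e i) (e, i), ?_⟩⟩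
  intro e e' i i' hi hii hcc
  have hcc' : c (vert e i) (e, i) = c (vert e i) (e', i') := by rw [hcc, hii]
  have := hc _ hi (show (e, i) ∈ {p | vert p.1 p.2 = vert e i} from rfl)
    (show (e', i') ∈ {p | vert p.1 p.2 = vert e i} from hii.symm) hcc'
  exact ⟨congrArg Prod.fst this, congrArg Prod.snd this⟩

namespace Graph.Attachment

variable {V E : Type*} {G : Graph V E} {R : Set V}

open Classical in
/-- The vertex of the modified graph at the end `i` of the edge `e`: an original vertex
`Sum.inl v`, or the corner `Sum.inr (v, c)` of the triangle that replaces a vertex `v ∈ R`. -/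
noncomputable def newEnd (A : G.Attachment R) (e : G.edgeSet) (i : Fin 2) : V ⊕ V × Fin 3 :=
  if A.vert e i ∈ R then Sum.inr (A.vert e i, A.corner e i) else Sum.inl (A.vert e i)

/-- The signed graph `G'`: every vertex `v ∈ R` is replaced by a triangle, each of whose three sides
is doubled to a positive and a negative edge. The edges of `G` are positive. -/
noncomputable def expand (A : G.Attachment R) : SignedGraph (V ⊕ V × Fin 3) (OrnElement V E) where
  vertexSet := Sum.inl '' (G.vertexSet \ R) ∪ Sum.inr '' (R ×ˢ univ)
  edgeSet := (OrnElement.edge '' G.edgeSet) ∪ {x | ∃ v ∈ R, ∃ k s, x = .tri v k s}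
  IsLink x a b :=
    (∃ e : G.edgeSet, x = .edge e ∧ s(a, b) = s(A.newEnd e 0, A.newEnd e 1)) ∨
    (∃ v ∈ R, ∃ k s, x = .tri v k s ∧ s(a, b) = s(Sum.inr (v, k + 1), Sum.inr (v, k + 2)))
  isLink_symm x _ := ⟨fun a b h => by rwa [Sym2.eq_swap]⟩
  eq_or_eq_of_isLink_of_isLink := by
    have key : ∀ {x y v w : V ⊕ V × Fin 3} {p}, s(x, y) = p → s(v, w) = p → x = v ∨ x = w := by
      intro x y v w p h h'
      have := Sym2.mem_mk_left x y
      rwa [h, ← h', Sym2.mem_iff] at this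
    rintro x a b c d (⟨e, rfl, h⟩ | ⟨v, hv, k, s, rfl, h⟩) (⟨e', he, h'⟩ | ⟨v', hv', k', s', he, h'⟩)
    · cases Subtype.ext (OrnElement.edge.inj he)
      exact key h h'
    · cases he
    · cases he
    · cases he
      exact key h h'
  edge_mem_iff_exists_isLink x := by
    constructor
    · rintro (⟨e, he, rfl⟩ | ⟨v, hv, k, s, rfl⟩)
      · exact ⟨_, _, .inl ⟨⟨e, he⟩, rfl, rfl⟩⟩
      · exact ⟨_, _, .inr ⟨v, hv, k, s, rfl, rfl⟩⟩
    · rintro ⟨a, b, ⟨e, rfl, -⟩ | ⟨v, hv, k, s, rfl, -⟩⟩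
      · exact .inl ⟨e, e.2, rfl⟩
      · exact .inr ⟨v, hv, k, s, rfl⟩
  left_mem_of_isLink := by
    have hmem : ∀ e i, A.newEnd e i ∈
        (Sum.inl '' (G.vertexSet \ R) ∪ Sum.inr '' (R ×ˢ univ) : Set (V ⊕ V × Fin 3)) := by
      intro e i
      have hi : A.vert e i ∈ G.vertexSet := by
        fin_cases i
        · exact (A.isLink e).left_mem
        · exact (A.isLink e).right_mem
      rw [newEnd]
      split_ifs with h
      · exact .inr ⟨_, ⟨h, mem_univ _⟩, rfl⟩
      · exact .inl ⟨_, ⟨hi, h⟩, rfl⟩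
    rintro x a b (⟨e, rfl, h⟩ | ⟨v, hv, k, s, rfl, h⟩)
    · have := Sym2.mem_mk_left a b
      rw [h, Sym2.mem_iff] at this
      rcases this with rfl | rfl <;> exact hmem e _
    · have := Sym2.mem_mk_left a b
      rw [h, Sym2.mem_iff] at this
      rcases this with rfl | rfl <;> exact .inr ⟨_, ⟨hv, mem_univ _⟩, rfl⟩
  sign
    | .edge _ => 1
    | .tri _ _ s => s
    | .gadget _ _ => 1

end Graph.Attachment

section Gadget

variable {V : Type*} (E : Type*)

/-- The edge set `X_v` of the signed triangle at `v`. -/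
def triSet (v : V) : Set (OrnElement V E) := {x | ∃ k s, x = .tri v k s}

/-- The four further elements of the copy of `K₅` at `v`. -/
def gadgetSet (v : V) : Set (OrnElement V E) := {x | ∃ j, x = .gadget v j}

variable {E} in
/-- The labelling of the edges of `K₅`, with vertices `0, 1, 2, 3, 4`, by the elements of
`triSet E v ∪ gadgetSet E v`. The vertices `0, 1, 2, 3` span the copy of `K₄` whose cycle matroid is
represented by the signed triangle: its edges are the positive edges of the triangle with corners
`0, 1, 2`, and the negative edge opposite to the corner `k` stands for the edge `3k`. The gadget
elements are the edges at the vertex `4`. (The value at `OrnElement.edge` is irrelevant.) -/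
def k5Edge : OrnElement V E → Sym2 (Fin 5)
  | .edge _ => s(0, 0)
  | .tri _ k s => if s = 1 then s((k + 1).castLE (by decide), (k + 2).castLE (by decide))
      else s(3, k.castLE (by decide))
  | .gadget _ j => s(4, j.castLE (by decide))

/-- The copy of `M(K₅)` with elements `triSet E v ∪ gadgetSet E v`. -/
def k5Copy (v : V) : Matroid (OrnElement V E) :=
  (Graph.ofSimpleGraph (⊤ : SimpleGraph (Fin 5))).cycleMatroid.comapOn
    (triSet E v ∪ gadgetSet E v) k5Edge

end Gadget

namespace Graph.Attachment

variable {V E : Type*} {G : Graph V E} {R : Set V}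

/-- `A.Glued S P`: the matroid `P` is obtained from `M(G')` by taking, for the vertices `v ∈ S` one
after the other, the generalized parallel connection with a copy of `M(K₅)` over the edge
set `X_v`. -/
inductive Glued (A : G.Attachment R) : Set V → Matroid (OrnElement V E) → Prop
  | base : Glued A ∅ A.expand.matroid
  | step {S : Set V} {M P : Matroid (OrnElement V E)} {v : V} (h : Glued A S M) (hv : v ∈ R)
      (hvS : v ∉ S) (hP : M.IsGenParallelConnection (k5Copy E v) P) : Glued A (insert v S) P

/-- `N` is the ornamentation `Or(G,R)` (constructed with the choices `A`): generalized parallel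
connections are taken at all vertices of `R`, and then the sets `X_v` are deleted. -/
def IsOrnamentation (A : G.Attachment R) (N : Matroid (OrnElement V E)) : Prop :=
  ∃ P, A.Glued R P ∧ N = P.delete (⋃ v ∈ R, triSet E v)

end Graph.Attachment

/-- The inclusion of the edge set of the given graph. -/
def OrnElement.edgeEmbedding (V E : Type*) : E ↪ OrnElement V E :=
  ⟨OrnElement.edge, fun _ _ h => OrnElement.edge.inj h⟩

/-! One family of vectors, `A.vec K`, represents every stage of the construction over every field
`K` in which `2 ≠ 0`. Start from the signed incidence vectors of the expanded graph. At a vertex of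
`R` with corner vectors `e₀, e₁, e₂`, assign to the vertices of K₅ the vectors `e₀, e₁, e₂, e₀ + e₁
+ e₂` and a new unit vector. Positive triangle edges are the differences `eᵢ - eⱼ`, and the negative
edge opposite `k` is, up to sign, `(e₀ + e₁ + e₂) - e_k`; so signed triangle and K₄ agree, and the
gadget elements are the four remaining differences (`representedBy_k5Copy`).

The gadget elements have new coordinate 1, everything glued before has new coordinate 0, and two
gadget elements differ by a multiple of a triangle element. This forces the flats to be those of a
generalized parallel connection (`RepresentedBy.isGenParallelConnection`). Since flats determine a
matroid, every glued matroid is the vector matroid of these vectors (`Glued.representedBy`). Over ℚ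
this gives existence and independence of the order; over GF(3) and GF(5) it gives the two
representations.

For the minor, contract the three gadget elements from the corners to the fifth vertex. Linearly
this identifies the three corners at each vertex of `R`, so edge vectors become the incidence
vectors of `G`; the fourth gadget element is deleted. -/

/-! ### Linear independence under rescaling and quotients -/

section LinearIndepOn

variable {α K W U : Type*} [Field K] [AddCommGroup W] [Module K W] [AddCommGroup U] [Module K U]

/-- Incidence columns depend on a choice of order of the two ends, so vectors are compared only up
to nonzero factors. -/
theorem linearIndepOn_iff_of_smul_eq {v w : α → W} {s : Set α}
    (h : ∀ x ∈ s, ∃ c : K, c ≠ 0 ∧ v x = c • w x) :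
    LinearIndepOn K v s ↔ LinearIndepOn K w s := by
  choose! c hc hv using h
  have := LinearIndependent.units_smul_iff (R := K) (fun x : s => w x)
    (fun x : s => Units.mk0 (c x) (hc x x.2))
  rw [LinearIndepOn, LinearIndepOn, ← this]
  convert! Iff.rfl using 2
  ext x
  simp [hv x x.2, Units.smul_def]

/-- The linear form of contracting `C`: the kernel of `L` is exactly the span of `C`, so `L` induces
an injection on the quotient by that span. -/
theorem linearIndepOn_union_iff_of_ker {v : α → W} {I C : Set α} (L : W →ₗ[K] U)
    (hC : LinearIndepOn K v C) (hIC : Disjoint C I) (hL : ∀ c ∈ C, L (v c) = 0)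
    (hker : L.ker ≤ Submodule.span K (v '' C)) :
    LinearIndepOn K v (C ∪ I) ↔ LinearIndepOn K (L ∘ v) I := by
  have hle : Submodule.span K (v '' C) ≤ L.ker := by
    rw [Submodule.span_le]
    rintro _ ⟨c, hc, rfl⟩
    exact hL c hc
  rw [← hC.quotient_iff_union hIC]
  have hinj : Function.Injective ((Submodule.span K (v '' C)).liftQ L hle) := by
    rw [← LinearMap.ker_eq_bot, Submodule.ker_liftQ, eq_bot_iff, Submodule.map_le_iff_le_comap]
    exact hker.trans (by simp)
  rw [← LinearMap.linearIndepOn_iff_of_injOn (v := (Submodule.span K (v '' C)).mkQ ∘ v) _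
    hinj.injOn]
  exact Iff.rfl

end LinearIndepOn

/-! ### Vector matroids, their flats, and generalized parallel connections -/

namespace Matroid

variable {α K W : Type*} [Field K] [AddCommGroup W] [Module K W]

/-- `M` is represented on its ground set by the vectors `v e`. -/
def RepresentedBy (M : Matroid α) (K : Type*) [Field K] {W : Type*} [AddCommGroup W] [Module K W]
    (v : α → W) : Prop :=
  ∀ I ⊆ M.E, M.Indep I ↔ LinearIndepOn K v I

namespace RepresentedBy

variable {M N : Matroid α} {v : α → W}

theorem eq_of_ground_eq (hM : M.RepresentedBy K v) (hN : N.RepresentedBy K v) (h : M.E = N.E) :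
    M = N :=
  ext_indep h fun I hI => by rw [hM I hI, hN I (h ▸ hI)]

theorem restrict (hM : M.RepresentedBy K v) {S : Set α} (hS : S ⊆ M.E) :
    (M.restrict S).RepresentedBy K v := by
  intro I hI
  rw [restrict_indep_iff, hM I (hI.trans hS), and_iff_left (show I ⊆ S from hI)]

theorem delete (hM : M.RepresentedBy K v) (D : Set α) : (M.delete D).RepresentedBy K v :=
  hM.restrict sdiff_subset

theorem mem_span_iff (hM : M.RepresentedBy K v) {I : Set α} (hI : M.Indep I) {e : α}
    (he : e ∈ M.E) : v e ∈ Submodule.span K (v '' I) ↔ M.Indep (insert e I) → e ∈ I := by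
  have hl := (hM I hI.subset_ground).1 hI
  rw [hl.mem_span_iff, hM _ (insert_subset he hI.subset_ground)]

theorem span_eq_of_isBasis (hM : M.RepresentedBy K v) {I X : Set α} (h : M.IsBasis I X) :
    Submodule.span K (v '' I) = Submodule.span K (v '' X) := by
  refine le_antisymm (Submodule.span_mono (image_mono h.subset)) (Submodule.span_le.2 ?_)
  rintro _ ⟨e, he, rfl⟩
  exact (hM.mem_span_iff h.indep (h.subset_ground he)).2 fun hi => h.mem_of_insert_indep he hi

/-- Matroid closure is linear span cut down to the ground set, because a basis of a set has the same
span as the set. -/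
theorem isFlat_iff (hM : M.RepresentedBy K v) {F : Set α} (hF : F ⊆ M.E) :
    M.IsFlat F ↔ ∀ e ∈ M.E, v e ∈ Submodule.span K (v '' F) → e ∈ F := by
  constructor
  · intro h e he hs
    obtain ⟨I, hI⟩ := M.exists_isBasis F
    rw [← hM.span_eq_of_isBasis hI, hM.mem_span_iff hI.indep he] at hs
    refine h.subset_of_isBasis_of_isBasis (X := insert e I) hI ?_ (mem_insert e I)
    by_cases hi : M.Indep (insert e I)
    · rw [insert_eq_of_mem (hs hi)]
      exact hI.indep.isBasis_self
    · rw [hI.indep.insert_isBasis_iff_mem_closure, hI.indep.mem_closure_iff']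
      exact ⟨he, fun h => absurd h hi⟩
  · intro h
    refine ⟨fun I X hIF hIX e he => h e (hIX.subset_ground he) ?_, hF⟩
    rw [← hM.span_eq_of_isBasis hIF, hM.span_eq_of_isBasis hIX]
    exact Submodule.subset_span ⟨e, he, rfl⟩

/-- A linear condition for a vector matroid to be a generalized parallel connection: the elements
of `M₂` outside `M₁` lie on an affine hyperplane off the span of `M₁`, and the line through any two
of them meets the hyperplane at infinity in a common element of `M₁` and `M₂`. -/
theorem isGenParallelConnection {M₁ M₂ P : Matroid α} (h₁ : M₁.RepresentedBy K v)
    (h₂ : M₂.RepresentedBy K v) (hP : P.RepresentedBy K v) (hE : P.E = M₁.E ∪ M₂.E)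
    (φ : W →ₗ[K] K) (hφ : ∀ e ∈ M₁.E, φ (v e) = 0) (hφ' : ∀ e ∈ M₂.E \ M₁.E, φ (v e) = 1)
    (hline : ∀ e ∈ M₂.E \ M₁.E, ∀ f ∈ M₂.E \ M₁.E, e = f ∨
      ∃ t ∈ M₁.E ∩ M₂.E, ∃ c : K, c ≠ 0 ∧ v e - v f = c • v t) :
    M₁.IsGenParallelConnection M₂ P := by
  refine ⟨(h₁.restrict inter_subset_left).eq_of_ground_eq (h₂.restrict inter_subset_right) rfl, hE,
    fun F hF => ?_⟩
  rw [hP.isFlat_iff (hE ▸ hF), h₁.isFlat_iff inter_subset_right, h₂.isFlat_iff inter_subset_right]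
  constructor
  · exact fun h => ⟨fun e he hs => ⟨h e (hE ▸ .inl he)
      (Submodule.span_mono (image_mono inter_subset_left) hs), he⟩,
      fun e he hs => ⟨h e (hE ▸ .inr he) (Submodule.span_mono (image_mono inter_subset_left) hs),
        he⟩⟩
  rintro ⟨hF₁, hF₂⟩
  have hker : Submodule.span K (v '' M₁.E) ≤ φ.ker := by
    rw [Submodule.span_le]
    rintro _ ⟨e, he, rfl⟩
    exact hφ e he
  -- The modularity argument. If `F` contains some `f` outside `M₁`, every other such element of `F`
  -- is `f` plus a multiple of some `t`, and `t` lies in `F` because `F ∩ M₂.E` is a flat. So `b` is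
  -- a vector from `F ∩ M₁.E` plus a multiple of `v f`, and `φ b = 0` kills that multiple.
  have hmod : ∀ b ∈ Submodule.span K (v '' (F ∩ M₂.E)), φ b = 0 →
      b ∈ Submodule.span K (v '' (F ∩ M₁.E)) := by
    intro b hb hb0
    by_cases hg : ∃ f ∈ F ∩ M₂.E, f ∉ M₁.E
    · obtain ⟨f, hf, hf₁⟩ := hg
      have hle : Submodule.span K (v '' (F ∩ M₂.E)) ≤
          Submodule.span K (v '' (F ∩ M₁.E)) ⊔ Submodule.span K {v f} := by
        rw [Submodule.span_le]
        rintro _ ⟨e, he, rfl⟩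
        by_cases he₁ : e ∈ M₁.E
        · exact Submodule.mem_sup_left (Submodule.subset_span ⟨e, ⟨he.1, he₁⟩, rfl⟩)
        · rcases hline e ⟨he.2, he₁⟩ f ⟨hf.2, hf₁⟩ with rfl | ⟨t, ht, c, hc, h⟩
          · exact Submodule.mem_sup_right (Submodule.subset_span rfl)
          · have htF : t ∈ F ∩ M₂.E := by
              refine hF₂ t ht.2 ?_
              rw [← Submodule.smul_mem_iff _ hc, ← h]
              exact Submodule.sub_mem _ (Submodule.subset_span ⟨e, he, rfl⟩)
                (Submodule.subset_span ⟨f, hf, rfl⟩)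
            rw [SetLike.mem_coe, ← sub_add_cancel (v e) (v f), h]
            exact Submodule.add_mem_sup (Submodule.smul_mem _ _
              (Submodule.subset_span ⟨t, ⟨htF.1, ht.1⟩, rfl⟩)) (Submodule.subset_span rfl)
      obtain ⟨w, hw, z, hz, rfl⟩ := Submodule.mem_sup.1 (hle hb)
      obtain ⟨c, rfl⟩ := Submodule.mem_span_singleton.1 hz
      have hw0 : φ w = 0 := hker (Submodule.span_mono (image_mono inter_subset_right) hw)
      rw [map_add, hw0, map_smul, hφ' f ⟨hf.2, hf₁⟩] at hb0
      have hc : c = 0 := by simpa using hb0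
      simpa [hc] using hw
    · push Not at hg
      exact Submodule.span_mono (image_mono (show F ∩ M₂.E ⊆ F ∩ M₁.E from fun e he => ⟨he.1, hg e he⟩)) hb
  have hspan : Submodule.span K (v '' F) =
      Submodule.span K (v '' (F ∩ M₁.E)) ⊔ Submodule.span K (v '' (F ∩ M₂.E)) := by
    rw [← Submodule.span_union, ← image_union, ← inter_union_distrib_left,
      inter_eq_self_of_subset_left hF]
  -- Split `v e` along the two parts of `F`. Since `φ` vanishes on `v e` and on the first summand,
  -- it vanishes on the second, which `hmod` moves into the span of the first part.
  have case₁ : ∀ e ∈ M₁.E, v e ∈ Submodule.span K (v '' F) → e ∈ F := by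
    intro e he hs
    rw [hspan] at hs
    obtain ⟨a, ha, b, hb, hab⟩ := Submodule.mem_sup.1 hs
    have ha0 : φ a = 0 := hker (Submodule.span_mono (image_mono inter_subset_right) ha)
    have hb0 : φ b = 0 := by
      have := congrArg φ hab
      rwa [map_add, ha0, zero_add, hφ e he] at this
    exact (hF₁ e he (hab ▸ Submodule.add_mem _ ha (hmod b hb hb0))).1
  intro e he hs
  by_cases he₁ : e ∈ M₁.E
  · exact case₁ e he₁ hs
  have he₂ : e ∈ M₂.E := (hE ▸ he).resolve_left he₁
  -- As `φ (v e) = 1`, the set `F` cannot lie in the hyperplane `φ = 0`. The line from `e` to the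
  -- resulting `f` meets that hyperplane in an element `t` of `M₁`, so `case₁` puts `t` in `F`, and
  -- then `e` is spanned by `t` and `f` inside `M₂`.
  have hg : ∃ f ∈ F, f ∉ M₁.E := by
    by_contra! hg
    have h0 : φ (v e) = 0 := hker (Submodule.span_mono (image_mono hg) hs)
    rw [hφ' e ⟨he₂, he₁⟩] at h0
    exact one_ne_zero h0
  obtain ⟨f, hf, hf₁⟩ := hg
  have hf₂ : f ∈ M₂.E := (hF hf).resolve_left hf₁
  rcases hline e ⟨he₂, he₁⟩ f ⟨hf₂, hf₁⟩ with rfl | ⟨t, ht, c, hc, h⟩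
  · exact hf
  have htF : t ∈ F := by
    refine case₁ t ht.1 ?_
    rw [← Submodule.smul_mem_iff _ hc, ← h]
    exact Submodule.sub_mem _ hs (Submodule.subset_span ⟨f, hf, rfl⟩)
  refine (hF₂ e he₂ ?_).1
  rw [← sub_add_cancel (v e) (v f), h]
  exact Submodule.add_mem _ (Submodule.smul_mem _ _ (Submodule.subset_span ⟨t, ⟨htF, ht.2⟩, rfl⟩))
    (Submodule.subset_span ⟨f, ⟨hf, hf₂⟩, rfl⟩)

/-- Finitely many vectors span a finite-dimensional space, and coordinates in a basis of it are the
required columns. Labels outside the ground set get the zero column. -/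
theorem isRepresentableOver (hM : M.RepresentedBy K v) (hfin : M.E.Finite) :
    M.IsRepresentableOver K := by
  classical
  have hfd : FiniteDimensional K (Submodule.span K (v '' M.E)) :=
    FiniteDimensional.span_of_finite K (hfin.image v)
  let b := Module.finBasis K (Submodule.span K (v '' M.E))
  let w : α → Submodule.span K (v '' M.E) := fun e =>
    if h : e ∈ M.E then ⟨v e, Submodule.subset_span ⟨e, h, rfl⟩⟩ else 0
  refine ⟨_, fun e => b.equivFun (w e), fun I hI => ?_⟩
  have h1 := LinearMap.linearIndepOn_iff_of_injOn (R := K) (v := w) (s := I)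
    b.equivFun.toLinearMap b.equivFun.injective.injOn
  have h2 := LinearMap.linearIndepOn_iff_of_injOn (R := K) (v := w) (s := I)
    (Submodule.subtype _) (Submodule.subtype_injective _).injOn
  rw [hM I hI]
  refine Iff.trans (linearIndepOn_congr fun e he => ?_) (h2.trans h1.symm)
  simp [w, hI he]

end RepresentedBy

/-- The closure of a set is the intersection of the flats containing its part in the ground set, so
flats determine the matroid. -/
theorem eq_of_isFlat_iff {M N : Matroid α} (hE : M.E = N.E)
    (h : ∀ F ⊆ M.E, M.IsFlat F ↔ N.IsFlat F) : M = N := by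
  refine ext_closure fun X => ?_
  rw [closure_def, closure_def, hE]
  congr! 3 with F
  refine and_congr_left fun _ => ⟨fun hF => (h F hF.subset_ground).1 hF,
    fun hF => (h F (hE ▸ hF.subset_ground)).2 hF⟩

theorem IsGenParallelConnection.unique {M₁ M₂ P Q : Matroid α}
    (hP : M₁.IsGenParallelConnection M₂ P) (hQ : M₁.IsGenParallelConnection M₂ Q) : P = Q :=
  eq_of_isFlat_iff (hP.ground_eq.trans hQ.ground_eq.symm) fun F hF => by
    rw [hP.isFlat_iff F (hP.ground_eq ▸ hF), hQ.isFlat_iff F (hP.ground_eq ▸ hF)]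

theorem exists_representedBy (E : Set α) (v : α → W) :
    ∃ M : Matroid α, M.E = E ∧ M.RepresentedBy K v := by
  obtain ⟨M, rfl, h⟩ := exists_matroid_linearIndepOn (K := K) E v
  exact ⟨M, rfl, fun I hI => by rw [h, and_iff_right hI]⟩

end Matroid

/-! ### Incidence vectors of signed and ordinary graphs -/

theorem SignedGraph.representedBy_column {V E : Type*} (Γ : SignedGraph V E) {K : Type*} [Field K]
    (h2 : (2 : K) ≠ 0) : Γ.matroid.RepresentedBy K (Γ.column K) := fun I hI => by
  change Γ.IsIndep I ↔ _
  rw [Γ.isIndep_iff_linearIndepOn h2, and_iff_right (show I ⊆ Γ.edgeSet from hI)]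

theorem Graph.representedBy_column {V E : Type*} (G : Graph V E) {K : Type*} [Field K]
    (h2 : (2 : K) ≠ 0) : G.cycleMatroid.RepresentedBy K ((SignedGraph.mk G 1).column K) :=
  fun I hI => by
    change G.IsForest I ↔ _
    rw [G.isForest_iff_isIndep]
    exact (SignedGraph.mk G 1).representedBy_column h2 I hI

/-- Interchanging the ends of an edge of sign `σ` multiplies `x - σ y` by `-σ`, because `σ² = 1`. -/
theorem SignedGraph.column_eq_smul {V E : Type*} (Γ : SignedGraph V E) (K : Type*) [Field K]
    {e : E} {x y : V} (h : Γ.IsLink e x y) : ∃ c : K, c ≠ 0 ∧ Γ.column K e =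
      c • (Finsupp.single x 1 - ((Γ.sign e : ℤ) : K) • Finsupp.single y 1) := by
  obtain ⟨a, b, hab, hc⟩ := Γ.exists_column_eq K ((Γ.edge_mem_iff_exists_isLink e).2 ⟨x, y, h⟩)
  rcases Graph.IsLink.eq_and_eq_or_eq_and_eq h hab with ⟨rfl, rfl⟩ | ⟨rfl, rfl⟩
  · exact ⟨1, one_ne_zero, by rw [hc, one_smul]⟩
  · have hσ := sign_mul_self (K := K) (Γ.sign e)
    refine ⟨-((Γ.sign e : ℤ) : K), fun h0 => ?_, ?_⟩
    · rw [neg_eq_zero.1 h0] at hσ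
      simp at hσ
    · rw [hc, smul_sub, smul_smul, neg_mul, hσ]
      module

/-! ### The vectors of K₅ over the signed triangle -/

section K5

variable {V E : Type*} (K : Type*) [Field K]

/-- The vector of the vertex `j` of the copy of `K₅` at `v`: the corners, their sum, and a new
coordinate. -/
noncomputable def k5Vertex (v : V) : Fin 5 → (V ⊕ V × Fin 3 →₀ K) × (V →₀ K) :=
  ![(Finsupp.single (Sum.inr (v, 0)) 1, 0), (Finsupp.single (Sum.inr (v, 1)) 1, 0),
    (Finsupp.single (Sum.inr (v, 2)) 1, 0),
    (∑ i, Finsupp.single (Sum.inr (v, i)) 1, 0), (0, Finsupp.single v 1)]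

/-- The linear map that realizes the representation of `M(K₅)` by differences of the vectors of the
vertices. -/
noncomputable def k5Map (v : V) : (Fin 5 →₀ K) →ₗ[K] (V ⊕ V × Fin 3 →₀ K) × (V →₀ K) :=
  Finsupp.linearCombination K (k5Vertex K v)

variable {K}

theorem k5Map_single_sub_single (v : V) (i j : Fin 5) :
    k5Map K v (Finsupp.single i 1 - Finsupp.single j 1) = k5Vertex K v i - k5Vertex K v j := by
  simp [k5Map]

/-- The five vertex vectors satisfy one linear relation: the three corners add up to vertex 3. Its
coefficient sum is `3 - 1 = 2 ≠ 0`, so it is not among the vectors of coefficient sum zero, which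
contain all edge vectors of K₅. -/
theorem k5Map_injOn (h2 : (2 : K) ≠ 0) (v : V) {s : Set (Fin 5 →₀ K)}
    (hs : s ⊆ (Finsupp.linearCombination K (fun _ : Fin 5 => (1 : K))).ker) :
    InjOn (k5Map K v) s := by
  intro a ha b hb hab
  have ha' := LinearMap.mem_ker.1 (hs ha)
  have hb' := LinearMap.mem_ker.1 (hs hb)
  rw [Finsupp.linearCombination_apply, Finsupp.sum_fintype _ _ (by simp)] at ha' hb'
  rw [k5Map, Finsupp.linearCombination_apply, Finsupp.linearCombination_apply,
    Finsupp.sum_fintype _ _ (by simp), Finsupp.sum_fintype _ _ (by simp)] at hab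
  have h0 := DFunLike.congr_fun (congrArg Prod.fst hab) (Sum.inr (v, 0))
  have h1 := DFunLike.congr_fun (congrArg Prod.fst hab) (Sum.inr (v, 1))
  have h2' := DFunLike.congr_fun (congrArg Prod.fst hab) (Sum.inr (v, 2))
  have h4 := DFunLike.congr_fun (congrArg Prod.snd hab) v
  simp [k5Vertex, Fin.sum_univ_succ] at h0 h1 h2' h4 ha' hb'
  have h3 : a 3 = b 3 := by
    -- In the sum of the four coordinate equations vertex 3 is counted three times; subtracting the
    -- coefficient sum leaves it twice.
    have : (2 : K) * (a 3 - b 3) = 0 := by linear_combination h0 + h1 + h2' + h4 - ha' + hb'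
    exact sub_eq_zero.1 ((mul_eq_zero.1 this).resolve_left h2)
  ext i
  fin_cases i
  · simpa [h3] using h0
  · simpa [h3] using h1
  · simpa [h3] using h2'
  · exact h3
  · exact h4

end K5

/-! ### Representation of the glued matroids -/

namespace Graph.Attachment

variable {V E : Type*} {G : Graph V E} {R : Set V} (A : G.Attachment R) (K : Type*) [Field K]

/-- The vectors representing the successive generalized parallel connections. -/
noncomputable def vec : OrnElement V E → (V ⊕ V × Fin 3 →₀ K) × (V →₀ K)
  | .gadget v j => k5Vertex K v 4 - k5Vertex K v (j.castLE (by decide))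
  | x => (A.expand.column K x, 0)

theorem linearIndepOn_vec_iff {I : Set (OrnElement V E)} (hI : I ⊆ A.expand.edgeSet) :
    LinearIndepOn K (A.vec K) I ↔ LinearIndepOn K (A.expand.column K) I := by
  have h := LinearMap.linearIndepOn_iff_of_injOn (R := K) (v := A.expand.column K) (s := I)
    (LinearMap.inl K (V ⊕ V × Fin 3 →₀ K) (V →₀ K)) LinearMap.inl_injective.injOn
  rw [← h]
  refine linearIndepOn_congr fun x hx => ?_
  rcases hI hx with ⟨e, he, rfl⟩ | ⟨v, hv, k, s, rfl⟩ <;> rfl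

variable {K}

theorem exists_vec_edge_eq (e : G.edgeSet) : ∃ c : K, c ≠ 0 ∧ A.vec K (.edge e) =
    c • (Finsupp.single (A.newEnd e 0) 1 - Finsupp.single (A.newEnd e 1) 1, 0) := by
  obtain ⟨c, hc, h⟩ := A.expand.column_eq_smul K
    (show A.expand.IsLink (.edge e) (A.newEnd e 0) (A.newEnd e 1) from .inl ⟨e, rfl, rfl⟩)
  exact ⟨c, hc, by simp [vec, h, show A.expand.sign (.edge e) = 1 from rfl]⟩

theorem exists_vec_tri_eq {v : V} (hv : v ∈ R) (k : Fin 3) (s : ℤˣ) :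
    ∃ c : K, c ≠ 0 ∧ A.vec K (.tri v k s) = c • (Finsupp.single (Sum.inr (v, k + 1)) 1 -
      ((s : ℤ) : K) • Finsupp.single (Sum.inr (v, k + 2)) 1, 0) := by
  obtain ⟨c, hc, h⟩ := A.expand.column_eq_smul K
    (show A.expand.IsLink (.tri v k s) (Sum.inr (v, k + 1)) (Sum.inr (v, k + 2)) from
      .inr ⟨v, hv, k, s, rfl, rfl⟩)
  refine ⟨c, hc, ?_⟩
  change ((A.expand.column K (.tri v k s), 0) : _ × (V →₀ K)) = _
  rw [h, Prod.smul_mk, smul_zero]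
  rfl

/-- The labelling by edges of K₅ matches the vectors because `e_{k+1} + e_{k+2} = (e₀ + e₁ + e₂) -
e_k`: negative edges become edges at vertex 3. -/
theorem exists_vec_eq_of_k5Edge {v : V} (hv : v ∈ R) {x : OrnElement V E}
    (hx : x ∈ triSet E v ∪ gadgetSet E v) : ∃ i j, i ≠ j ∧ k5Edge x = s(i, j) ∧
      ∃ c : K, c ≠ 0 ∧ A.vec K x = c • (k5Vertex K v i - k5Vertex K v j) := by
  rcases hx with ⟨k, s, rfl⟩ | ⟨j, rfl⟩
  · obtain ⟨c, hc, h⟩ := A.exists_vec_tri_eq (K := K) hv k s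
    rcases Int.units_eq_one_or s with rfl | rfl
    · refine ⟨(k + 1).castLE (by decide), (k + 2).castLE (by decide), ?_, by simp [k5Edge], c, hc, ?_⟩
      · fin_cases k <;> decide
      · rw [h]
        fin_cases k <;> simp [k5Vertex]
    · refine ⟨3, k.castLE (by decide), ?_, by simp [k5Edge], c, hc, ?_⟩
      · fin_cases k <;> decide
      · rw [h]
        congr 1
        fin_cases k <;> simp [k5Vertex, Fin.sum_univ_succ] <;> abel
  · refine ⟨4, _, ?_, rfl, 1, one_ne_zero, by simp [vec]⟩
    fin_cases j <;> decide

theorem representedBy_k5Copy (h2 : (2 : K) ≠ 0) {v : V} (hv : v ∈ R) :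
    (k5Copy E v).RepresentedBy K (A.vec K) := by
  intro I hI
  set H := Graph.ofSimpleGraph (⊤ : SimpleGraph (Fin 5))
  let col := (SignedGraph.mk H 1).column K
  have hcol : ∀ i j, i ≠ j → ∃ c : K, c ≠ 0 ∧
      col s(i, j) = c • (Finsupp.single i 1 - Finsupp.single j 1) := by
    intro i j hij
    obtain ⟨c, hc, h⟩ := (SignedGraph.mk H 1).column_eq_smul K
      (show H.IsLink s(i, j) i j from ⟨rfl, by simpa using hij⟩)
    exact ⟨c, hc, by simpa using h⟩
  have hsum : Submodule.span K ((col ∘ k5Edge) '' I) ≤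
      (Finsupp.linearCombination K (fun _ : Fin 5 => (1 : K))).ker := by
    rw [Submodule.span_le]
    rintro _ ⟨x, hx, rfl⟩
    obtain ⟨i, j, hij, he, -⟩ := A.exists_vec_eq_of_k5Edge (K := K) hv (hI hx)
    obtain ⟨c, -, h⟩ := hcol i j hij
    simp [he, h]
  have hedge : k5Edge '' I ⊆ H.cycleMatroid.E := by
    rintro _ ⟨x, hx, rfl⟩
    obtain ⟨i, j, hij, he, -⟩ := A.exists_vec_eq_of_k5Edge (K := K) hv (hI hx)
    change k5Edge x ∈ (⊤ : SimpleGraph (Fin 5)).edgeSet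
    simpa [he] using hij
  rw [k5Copy, Matroid.comapOn_indep_iff, H.representedBy_column h2 _ hedge,
    and_iff_left (show I ⊆ triSet E v ∪ gadgetSet E v from hI)]
  have h1 : LinearIndepOn K (A.vec K) I ↔ LinearIndepOn K (k5Map K v ∘ (col ∘ k5Edge)) I := by
    refine linearIndepOn_iff_of_smul_eq fun x hx => ?_
    obtain ⟨i, j, hij, he, c, hc, h⟩ := A.exists_vec_eq_of_k5Edge (K := K) hv (hI hx)
    obtain ⟨d, hd, h'⟩ := hcol i j hij
    refine ⟨c * d⁻¹, mul_ne_zero hc (inv_ne_zero hd), ?_⟩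
    rw [h, Function.comp_apply, Function.comp_apply, he, h', map_smul, k5Map_single_sub_single,
      smul_smul, mul_assoc, inv_mul_cancel₀ hd, mul_one]
  rw [h1, LinearMap.linearIndepOn_iff_of_injOn _ (k5Map_injOn h2 v hsum)]
  -- Independence in `comapOn` also asks for `k5Edge` to be injective on `I`; independence of the
  -- composed family already forces this.
  exact ⟨fun h => h.1.comp_of_image h.2, fun h => ⟨h.image_of_comp, h.injOn.of_comp⟩⟩

/-- The ground set of the matroid obtained after the generalized parallel connections at the
vertices of `S`. -/
theorem Glued.ground_eq {A : G.Attachment R} {S : Set V} {P : Matroid (OrnElement V E)}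
    (h : A.Glued S P) : P.E = A.expand.edgeSet ∪ ⋃ v ∈ S, gadgetSet E v := by
  induction h with
  | base => simp; rfl
  | @step S M P v h hv hvS hP ih =>
    have hT : triSet E v ⊆ A.expand.edgeSet := by
      rintro _ ⟨k, s, rfl⟩
      exact .inr ⟨v, hv, k, s, rfl⟩
    rw [hP.ground_eq, ih, biUnion_insert, k5Copy, Matroid.comapOn_ground_eq]
    ext x
    have := @hT x
    simp only [mem_union]
    tauto

/-- The separating functional is the new coordinate at `v`, which is zero on `M` since `v` has not
been used yet. The line through gadget elements `i` and `j` meets the hyperplane in the triangle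
element labelled by the edge `ij` of K₄. -/
theorem Glued.isGenParallelConnection {A : G.Attachment R} {S : Set V}
    {M P : Matroid (OrnElement V E)} (h2 : (2 : K) ≠ 0) (h : A.Glued S M)
    (hM : M.RepresentedBy K (A.vec K)) {v : V} (hv : v ∈ R) (hvS : v ∉ S)
    (hP : P.RepresentedBy K (A.vec K)) (hE : P.E = M.E ∪ (k5Copy E v).E) :
    M.IsGenParallelConnection (k5Copy E v) P := by
  have hT : ∀ k s, OrnElement.tri v k s ∈ M.E ∩ (k5Copy E v).E := fun k s =>
    ⟨h.ground_eq ▸ .inl (.inr ⟨v, hv, k, s, rfl⟩), .inl ⟨k, s, rfl⟩⟩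
  have hdiff : ∀ e ∈ (k5Copy E v).E \ M.E, ∃ j, e = .gadget v j := by
    rintro e ⟨⟨k, s, rfl⟩ | he, heM⟩
    · exact absurd (hT k s).1 heM
    · exact he
  refine hM.isGenParallelConnection (A.representedBy_k5Copy h2 hv) hP hE
    (Finsupp.lapply v ∘ₗ LinearMap.snd K _ _) ?_ ?_ ?_
  · intro e he
    rw [h.ground_eq] at he
    rcases he with (⟨e, he, rfl⟩ | ⟨u, hu, k, s, rfl⟩) | he
    · simp [vec]
    · simp [vec]
    · simp only [mem_iUnion] at he
      obtain ⟨u, hu, j, rfl⟩ := he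
      have huv : u ≠ v := fun h => hvS (h ▸ hu)
      fin_cases j <;> simp [vec, k5Vertex, huv]
  · intro e he
    obtain ⟨j, rfl⟩ := hdiff e he
    fin_cases j <;> simp [vec, k5Vertex]
  · intro e he f hf
    obtain ⟨i, rfl⟩ := hdiff e he
    obtain ⟨j, rfl⟩ := hdiff f hf
    by_cases hij : i = j
    · exact .inl (by rw [hij])
    have hex : ∃ t ∈ triSet E v,
        (k5Edge t = s(i.castLE (by decide), j.castLE (by decide)) : Prop) := by
      have : ∃ k : Fin 3, ∃ s : ℤˣ, k5Edge (OrnElement.tri (E := E) v k s) =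
          s(i.castLE (by decide), j.castLE (by decide)) := by
        simp only [k5Edge]
        clear he hf
        revert i j
        decide
      obtain ⟨k, s, h⟩ := this
      exact ⟨_, ⟨k, s, rfl⟩, h⟩
    obtain ⟨t, ht, hte⟩ := hex
    obtain ⟨a, b, -, hab, c, hc, hvec⟩ :=
      A.exists_vec_eq_of_k5Edge (K := K) hv (x := t) (.inl ht)
    have htE : t ∈ M.E ∩ (k5Copy E v).E := by
      obtain ⟨k, s, rfl⟩ := ht
      exact hT k s
    rw [hte, Sym2.eq_iff] at hab
    have hdif : A.vec K (.gadget v i) - A.vec K (.gadget v j) =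
        k5Vertex K v (j.castLE (by decide)) - k5Vertex K v (i.castLE (by decide)) := by
      simp [vec]
    rcases hab with ⟨rfl, rfl⟩ | ⟨rfl, rfl⟩
    · refine .inr ⟨t, htE, -c⁻¹, neg_ne_zero.2 (inv_ne_zero hc), ?_⟩
      rw [hvec, smul_smul, neg_mul, inv_mul_cancel₀ hc, hdif]
      module
    · refine .inr ⟨t, htE, c⁻¹, inv_ne_zero hc, ?_⟩
      rw [hvec, smul_smul, inv_mul_cancel₀ hc, hdif, one_smul]

/-- The matroid `P` is known only through its flats. The vector matroid `Q` on the same ground set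
is also a generalized parallel connection, hence equals `P`. -/
theorem Glued.representedBy {A : G.Attachment R} {S : Set V} {P : Matroid (OrnElement V E)}
    (h2 : (2 : K) ≠ 0) (h : A.Glued S P) : P.RepresentedBy K (A.vec K) := by
  induction h with
  | base =>
    intro I hI
    rw [A.linearIndepOn_vec_iff K hI, A.expand.representedBy_column h2 I hI]
  | @step S M P v h hv hvS hP ih =>
    obtain ⟨Q, hQE, hQ⟩ := Matroid.exists_representedBy (K := K) (M.E ∪ (k5Copy E v).E) (A.vec K)
    rwa [hP.unique (h.isGenParallelConnection h2 ih hv hvS hQ hQE)]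

theorem exists_glued (A : G.Attachment R) {S : Set V} (hS : S.Finite) (hSR : S ⊆ R) :
    ∃ P, A.Glued S P := by
  induction S, hS using Set.Finite.induction_on with
  | empty => exact ⟨_, .base⟩
  | @insert v S hvS _ ih =>
    obtain ⟨M, hM⟩ := ih ((subset_insert v S).trans hSR)
    have hv := hSR (mem_insert v S)
    have h2 : (2 : ℚ) ≠ 0 := two_ne_zero
    obtain ⟨P, hPE, hP⟩ := Matroid.exists_representedBy (K := ℚ) (M.E ∪ (k5Copy E v).E) (A.vec ℚ)
    exact ⟨P, .step hM hv hvS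
      (hM.isGenParallelConnection h2 (hM.representedBy h2) hv hvS hP hPE)⟩

/-- The vectors and the ground set depend only on `S`, not on the order in which its vertices were
used. -/
theorem Glued.unique {A : G.Attachment R} {S : Set V} {P Q : Matroid (OrnElement V E)}
    (hP : A.Glued S P) (hQ : A.Glued S Q) : P = Q :=
  (hP.representedBy (K := ℚ) two_ne_zero).eq_of_ground_eq (hQ.representedBy (K := ℚ) two_ne_zero)
    (hP.ground_eq.trans hQ.ground_eq.symm)

end Graph.Attachment

/-! ### Finiteness, and the cycle matroid as a minor -/

theorem Graph.IsCubic.finite_edgeSet {V E : Type*} {G : Graph V E} (hG : G.IsCubic)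
    (hfin : G.vertexSet.Finite) : G.edgeSet.Finite := by
  refine (hfin.biUnion (t := fun v => {e | G.IsNonloopAt e v} ∪ {e | G.IsLoopAt e v})
    fun v hv => ?_).subset ?_
  · have h := hG v hv
    refine Finite.union (finite_of_encard_le_coe (k := 3) ?_) (finite_of_encard_le_coe (k := 3) ?_)
    · exact le_self_add.trans h.le
    · exact (le_mul_of_one_le_left zero_le (by norm_num)).trans (le_add_self.trans h.le)
  · intro e he
    obtain ⟨x, y, hxy⟩ := (G.edge_mem_iff_exists_isLink e).1 he
    exact mem_biUnion hxy.left_mem (hxy.inc_left.isLoopAt_or_isNonloopAt.symm)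

namespace Graph.Attachment

variable {V E : Type*} {G : Graph V E} {R : Set V} (A : G.Attachment R) {K : Type*} [Field K]

/-- The elements at the vertices of `S` that join the corners to the fifth vertex of `K₅`. -/
def cornerGadgets (E : Type*) (S : Set V) : Set (OrnElement V E) :=
  {x | ∃ v ∈ S, ∃ i : Fin 3, x = .gadget v i.castSucc}

theorem vec_gadget_castSucc (v : V) (i : Fin 3) :
    A.vec K (.gadget v i.castSucc) = (-Finsupp.single (Sum.inr (v, i)) 1, Finsupp.single v 1) := by
  fin_cases i <;> simp [vec, k5Vertex]

/-- The first components are the negatives of distinct unit vectors. -/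
theorem linearIndepOn_cornerGadgets (S : Set V) :
    LinearIndepOn K (A.vec K) (cornerGadgets E S) := by
  refine LinearIndepOn.of_comp (LinearMap.fst K _ _) ?_
  let f : V × Fin 3 → OrnElement V E := fun p => .gadget p.1 p.2.castSucc
  have hf : cornerGadgets E S ⊆ f '' univ := by
    rintro _ ⟨v, -, i, rfl⟩
    exact ⟨(v, i), trivial, rfl⟩
  refine LinearIndepOn.mono (LinearIndepOn.image_of_comp f _ ?_) hf
  have h : LinearIndependent K (fun p : V × Fin 3 =>
      (Finsupp.single (Sum.inr p) 1 : V ⊕ V × Fin 3 →₀ K)) :=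
    (Finsupp.linearIndependent_single_one K (V ⊕ V × Fin 3)).comp _ Sum.inr_injective
  refine (linearIndepOn_iff_of_smul_eq (w := fun p : V × Fin 3 =>
      (Finsupp.single (Sum.inr p) 1 : V ⊕ V × Fin 3 →₀ K)) fun p _ =>
      ⟨-1, neg_ne_zero.2 one_ne_zero, ?_⟩).2 (linearIndepOn_univ_iff.2 h)
  simp [f, vec_gadget_castSucc]

open Classical in
/-- The linear map that identifies the corners at each `v ∈ R` with the new coordinate at `v`. -/
noncomputable def mergeCorners (R : Set V) (K : Type*) [Field K] :
    (V ⊕ V × Fin 3 →₀ K) × (V →₀ K) →ₗ[K] (V ⊕ V × Fin 3 →₀ K) × (V →₀ K) :=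
  (Finsupp.linearCombination K (Sum.elim (fun v => (Finsupp.single (Sum.inl v) 1, 0))
    (fun p => if p.1 ∈ R then (0, Finsupp.single p.1 1)
      else (Finsupp.single (Sum.inr p) 1, 0)))).coprod (LinearMap.inr K _ _)

/-- Merging changes a vector only by corner gadget vectors, so a vector sent to zero is itself a
combination of them. -/
theorem ker_mergeCorners_le : (mergeCorners R K).ker ≤
    Submodule.span K (A.vec K '' cornerGadgets E R) := by
  have h : ∀ w, w - mergeCorners R K w ∈ Submodule.span K (A.vec K '' cornerGadgets E R) := by
    rintro ⟨a, b⟩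
    -- The new coordinates are fixed by the merging map, so only the first component matters.
    have hb : (a, b) - mergeCorners R K (a, b) = (a, 0) - mergeCorners R K (a, 0) := by
      simp [mergeCorners, ← sub_sub, sub_right_comm]
    rw [hb]
    clear hb
    induction a using Finsupp.induction_linear with
    | zero =>
      rw [Prod.mk_zero_zero, map_zero, sub_zero]
      exact Submodule.zero_mem _
    | add f g hf hg =>
      have : ((f + g, 0) : (V ⊕ V × Fin 3 →₀ K) × (V →₀ K)) = (f, 0) + (g, 0) := by simp
      rw [this, map_add, add_sub_add_comm]
      exact Submodule.add_mem _ hf hg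
    | single x c =>
      rcases x with u | ⟨v, i⟩
      · simp [mergeCorners]
      · by_cases hv : v ∈ R
        · have : ((Finsupp.single (Sum.inr (v, i)) c, 0) : (V ⊕ V × Fin 3 →₀ K) × (V →₀ K)) -
              mergeCorners R K (Finsupp.single (Sum.inr (v, i)) c, 0) =
              (-c) • A.vec K (.gadget v i.castSucc) := by
            rw [vec_gadget_castSucc]
            simp [mergeCorners, hv]
          rw [this]
          exact Submodule.smul_mem _ _ (Submodule.subset_span ⟨_, ⟨v, hv, i, rfl⟩, rfl⟩)
        · simp [mergeCorners, hv]
  intro w hw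
  have := h w
  rwa [LinearMap.mem_ker.1 hw, sub_zero] at this

theorem mergeCorners_vec_gadget {x : OrnElement V E} (hx : x ∈ cornerGadgets E R) :
    mergeCorners R K (A.vec K x) = 0 := by
  obtain ⟨v, hv, i, rfl⟩ := hx
  rw [vec_gadget_castSucc]
  simp [mergeCorners, hv]

open Classical in
/-- The embedding of the vertex space of `G` into the image of `mergeCorners`. -/
noncomputable def vertexMap (R : Set V) (K : Type*) [Field K] :
    (V →₀ K) →ₗ[K] (V ⊕ V × Fin 3 →₀ K) × (V →₀ K) :=
  Finsupp.linearCombination K fun v =>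
    if v ∈ R then (0, Finsupp.single v 1) else (Finsupp.single (Sum.inl v) 1, 0)

theorem vertexMap_injective : Function.Injective (vertexMap R K) := by
  -- A left inverse: forget the corner coordinates and add the original vertices to the new
  -- coordinates.
  let r : (V ⊕ V × Fin 3 →₀ K) × (V →₀ K) →ₗ[K] (V →₀ K) :=
    (Finsupp.linearCombination K (Sum.elim (fun v => Finsupp.single v 1) 0)).coprod LinearMap.id
  have h : r ∘ₗ vertexMap R K = LinearMap.id := by
    ext v : 2
    by_cases hv : v ∈ R <;> simp [r, vertexMap, hv]
  exact Function.LeftInverse.injective (g := r) (LinearMap.congr_fun h)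

theorem mergeCorners_newEnd (e : G.edgeSet) (i : Fin 2) :
    mergeCorners R K (Finsupp.single (A.newEnd e i) 1, 0) =
      vertexMap R K (Finsupp.single (A.vert e i) 1) := by
  by_cases h : A.vert e i ∈ R <;> simp [mergeCorners, vertexMap, newEnd, h]

theorem exists_mergeCorners_vec_edge_eq (e : G.edgeSet) : ∃ c : K, c ≠ 0 ∧
    mergeCorners R K (A.vec K (.edge e)) =
      c • vertexMap R K ((SignedGraph.mk G 1).column K e) := by
  obtain ⟨c, hc, h⟩ := A.exists_vec_edge_eq (K := K) e
  obtain ⟨d, hd, h'⟩ := (SignedGraph.mk G 1).column_eq_smul K (A.isLink e)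
  refine ⟨c * d⁻¹, mul_ne_zero hc (inv_ne_zero hd), ?_⟩
  have hsub : ((Finsupp.single (A.newEnd e 0) 1 - Finsupp.single (A.newEnd e 1) 1, 0) :
      (V ⊕ V × Fin 3 →₀ K) × (V →₀ K)) =
      (Finsupp.single (A.newEnd e 0) 1, 0) - (Finsupp.single (A.newEnd e 1) 1, 0) := by simp
  rw [h, h', map_smul, map_smul, smul_smul, mul_assoc, inv_mul_cancel₀ hd, mul_one, hsub, map_sub,
    mergeCorners_newEnd, mergeCorners_newEnd, ← map_sub]
  simp

/-- Modulo the corner gadgets, both ends of an edge become the original vertices of `G`, so its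
vector becomes a multiple of its incidence column in `G`. -/
theorem linearIndepOn_union_cornerGadgets_iff {J : Set E} (hJ : J ⊆ G.edgeSet) :
    LinearIndepOn K (A.vec K) (cornerGadgets E R ∪ OrnElement.edge '' J) ↔
      LinearIndepOn K ((SignedGraph.mk G 1).column K) J := by
  rw [linearIndepOn_union_iff_of_ker (mergeCorners R K) (A.linearIndepOn_cornerGadgets R) ?_
    (fun c hc => A.mergeCorners_vec_gadget hc) A.ker_mergeCorners_le,
    ← LinearMap.linearIndepOn_iff_of_injOn (R := K) (s := J) (vertexMap R K)
      vertexMap_injective.injOn]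
  · have h : LinearIndepOn K ((mergeCorners R K ∘ A.vec K) ∘ OrnElement.edge) J ↔
        LinearIndepOn K (vertexMap R K ∘ (SignedGraph.mk G 1).column K) J :=
      linearIndepOn_iff_of_smul_eq fun e he => A.exists_mergeCorners_vec_edge_eq ⟨e, hJ he⟩
    rw [← h]
    exact ⟨fun h => h.comp_of_image (OrnElement.edgeEmbedding V E).injective.injOn,
      fun h => h.image_of_comp⟩
  · rw [disjoint_left]
    rintro _ ⟨v, hv, i, rfl⟩ ⟨e, -, he⟩
    cases he

theorem IsOrnamentation.ground_eq {A : G.Attachment R} {N : Matroid (OrnElement V E)}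
    (h : A.IsOrnamentation N) : N.E = OrnElement.edge '' G.edgeSet ∪ ⋃ v ∈ R, gadgetSet E v := by
  obtain ⟨P, hP, rfl⟩ := h
  rw [Matroid.delete_ground, hP.ground_eq]
  ext x
  cases x <;> simp [expand, triSet, gadgetSet]

theorem IsOrnamentation.representedBy {A : G.Attachment R} {N : Matroid (OrnElement V E)}
    (h2 : (2 : K) ≠ 0) (h : A.IsOrnamentation N) : N.RepresentedBy K (A.vec K) := by
  obtain ⟨P, hP, rfl⟩ := h
  exact (hP.representedBy h2).delete _

theorem IsOrnamentation.finite {A : G.Attachment R} {N : Matroid (OrnElement V E)}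
    (h : A.IsOrnamentation N) (hE : G.edgeSet.Finite) (hR : R.Finite) : N.E.Finite := by
  rw [h.ground_eq]
  refine (hE.image _).union (hR.biUnion fun v _ => ?_)
  exact (finite_range (OrnElement.gadget v)).subset (by rintro _ ⟨j, rfl⟩; exact ⟨j, rfl⟩)

theorem IsOrnamentation.cycleMatroid_isMinor {A : G.Attachment R} {N : Matroid (OrnElement V E)}
    (h : A.IsOrnamentation N) :
    (G.cycleMatroid.mapEmbedding (OrnElement.edgeEmbedding V E)).IsMinor N := by
  have hN := h.representedBy (K := ℚ) two_ne_zero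
  have hCE : cornerGadgets E R ⊆ N.E := by
    rw [h.ground_eq]
    rintro _ ⟨v, hv, i, rfl⟩
    exact .inr (mem_biUnion hv ⟨_, rfl⟩)
  have hC : N.Indep (cornerGadgets E R) := (hN _ hCE).2 (A.linearIndepOn_cornerGadgets R)
  have hE : (G.cycleMatroid.mapEmbedding (OrnElement.edgeEmbedding V E)).E =
      OrnElement.edge '' G.edgeSet := rfl
  -- Contract the elements from corners to the fifth vertex and delete those from vertex 3 to the
  -- fifth vertex. Labels in the second set at vertices outside `R` are not in the ground set, so
  -- deleting them is harmless.
  refine ⟨cornerGadgets E R, {x | ∃ v, x = .gadget v 3}, Matroid.ext_indep ?_ ?_⟩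
  · rw [hE, Matroid.delete_ground, Matroid.contract_ground, h.ground_eq]
    ext x
    rcases x with e | ⟨v, k, s⟩ | ⟨v, j⟩
    · simp [cornerGadgets, gadgetSet]
    · simp [gadgetSet]
    · simp only [cornerGadgets, gadgetSet]
      refine ⟨?_, ?_⟩
      · rintro ⟨e, -, he⟩
        cases he
      · rintro ⟨⟨⟨e, -, he⟩ | hv, hv'⟩, hj⟩
        · cases he
        · simp only [mem_iUnion] at hv
          obtain ⟨u, hu, i, hi⟩ := hv
          cases hi
          induction j using Fin.lastCases with
          | last => exact absurd ⟨v, rfl⟩ hj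
          | cast i => exact absurd ⟨v, hu, i, rfl⟩ hv'
  · intro I hI
    obtain ⟨J, hJ, rfl⟩ := subset_image_iff.1 (hE ▸ hI)
    have hdC : Disjoint (OrnElement.edge '' J) (cornerGadgets E R) := by
      rw [disjoint_left]
      rintro _ ⟨e, -, rfl⟩ ⟨v, hv, i, he⟩
      cases he
    have hdD : Disjoint (OrnElement.edge '' J) {x : OrnElement V E | ∃ v, x = .gadget v 3} := by
      rw [disjoint_left]
      rintro _ ⟨e, -, rfl⟩ ⟨v, he⟩
      cases he
    have hJN : cornerGadgets E R ∪ OrnElement.edge '' J ⊆ N.E := by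
      refine union_subset hCE ?_
      rw [h.ground_eq]
      exact (image_mono hJ).trans subset_union_left
    rw [Matroid.delete_indep_iff, and_iff_left hdD, hC.contract_indep_iff, and_iff_right hdC,
      union_comm, hN _ hJN, A.linearIndepOn_union_cornerGadgets_iff hJ,
      ← G.representedBy_column two_ne_zero J hJ, Matroid.mapEmbedding_indep_iff,
      and_iff_left (show OrnElement.edge '' J ⊆ range (OrnElement.edgeEmbedding V E) from image_subset_range _ _)]
    change G.cycleMatroid.Indep (OrnElement.edgeEmbedding V E ⁻¹'
      (OrnElement.edgeEmbedding V E '' J)) ↔ _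
    rw [preimage_image_eq _ (OrnElement.edgeEmbedding V E).injective]

end Graph.Attachment

theorem lemma3p4 {V E : Type*} (G : Graph V E) (hfin : G.vertexSet.Finite) (hG : G.IsCubic)
    (R : Set V) (hR : R ⊆ G.vertexSet) :
    ∀ A : G.Attachment R,
      (∃! N : Matroid (OrnElement V E), A.IsOrnamentation N) ∧
      ∀ N : Matroid (OrnElement V E), A.IsOrnamentation N →
        N.IsDyadic ∧
        Matroid.IsMinor (G.cycleMatroid.mapEmbedding (OrnElement.edgeEmbedding V E)) N := by
  intro A
  have hRfin := hfin.subset hR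
  refine ⟨?_, fun N hN => ⟨⟨?_, ?_⟩, hN.cycleMatroid_isMinor⟩⟩
  · obtain ⟨P, hP⟩ := A.exists_glued hRfin subset_rfl
    refine ⟨_, ⟨P, hP, rfl⟩, ?_⟩
    rintro _ ⟨Q, hQ, rfl⟩
    rw [hQ.unique hP]
  · exact (hN.representedBy (by decide)).isRepresentableOver
      (hN.finite (hG.finite_edgeSet hfin) hRfin)
  · exact (hN.representedBy (by decide)).isRepresentableOver
      (hN.finite (hG.finite_edgeSet hfin) hRfin)
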